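/- Let $X=\widehat{\mathbb{Q}^2}$ be the Pontryagin dual of the discrete abelian group $\mathbb{Q}^2$, a compact group equipped with its normalized Haar measure, and let $SL_2(\mathbb{Q})$ act on $X$ by $\langle g\chi, v\rangle=\langle \chi, g^{-1}v\rangle$ for $g\in SL_2(\mathbb{Q})$, $\chi\in X$, $v\in\mathbb{Q}^2$. Let $Y$ be the quotient of $X$ by the relation $\phi\sim\phi'$, where $\phi'(v):=\phi(-v)$, with the quotient Borel structure and the image $\mu$ of the Haar measure. The action of $SL_2(\mathbb{Q})$ on $X$ induces an action of $PSL_2(\mathbb{Q})=SL_2(\mathbb{Q})/\{\pm 1\}$ on $Y$. Then the action $PSL_2(\mathbb{Q})\curvearrowright (Y,\mu)$ is probability-measure preserving and it is 1. (essentially) free: for every $g\neq 1$ in $PSL_2(\mathbb{Q})$, $gy\neq y$ for $\mu$-a.e. $y\in Y$; 2. weakly mixing: for every finite collection $\Omega$ of measurable subsets of $Y$ and every $\varepsilon>0$ there is $s\in PSL_2(\mathbb{Q})$ such that $|\mu(sA\cap B)-\mu(A)\mu(B)|<\varepsilon$ for all $A,B\in\Omega$; 3. prime, i.e. it has no non-trivial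 quotient actions: if $PSL_2(\mathbb{Q})\curvearrowright (Z,\nu)$ is a probability-measure-preserving action on a standard Borel probability space and $p:Y\to Z$ is a measure-preserving map with $p(gy)=gp(y)$ for every $g$ and $\mu$-a.e. $y$, then either $\nu$ is concentrated at a single point, or $p$ is an isomorphism modulo null sets. -/

import Mathlib

open MeasureTheory
open scoped MatrixGroups

universe u v w

/-! ## Probability-measure-preserving actions -/

section PMP

variable (G : Type v) {Y : Type w} [Group G] [MulAction G Y] [MeasurableSpace Y]

/-- The action of `G` on `(Y, μ)` is p.m.p. (probability-measure preserving). -/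
structure IsPMPAction (μ : Measure Y) : Prop where
  isProbabilityMeasure : IsProbabilityMeasure μ
  measurePreserving : ∀ g : G, MeasurePreserving (fun y : Y => g • y) μ μ

/-- (Essential) freeness of an action on a measure space: every `g ≠ 1` moves almost every point. -/
def IsFreeAction (μ : Measure Y) : Prop :=
  ∀ g : G, g ≠ 1 → ∀ᵐ y ∂μ, g • y ≠ y

/-- Weak mixing: for every finite collection `Ω` of measurable sets and every `ε > 0` there is
`s ∈ G` with `|μ (sA ∩ B) - μ A * μ B| < ε` for all `A, B ∈ Ω`. -/
def IsWeaklyMixingAction (μ : Measure Y) : Prop :=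
  ∀ Ω : Set (Set Y), Ω.Finite → (∀ A ∈ Ω, MeasurableSet A) → ∀ ε : ℝ, 0 < ε →
    ∃ s : G, ∀ A ∈ Ω, ∀ B ∈ Ω,
      |μ.real (((fun y : Y => s • y) '' A) ∩ B) - μ.real A * μ.real B| < ε

/-- `p : Y → Z` exhibits the p.m.p. action of `G` on `(Z, ν)` as a quotient action of the action of
`G` on `(Y, μ)`: it is measure preserving and equivariant almost everywhere. -/
structure IsQuotientAction {Z : Type*} [MulAction G Z] [MeasurableSpace Z]
    (μ : Measure Y) (ν : Measure Z) (p : Y → Z) : Prop where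
  isPMPAction : IsPMPAction G ν
  measurePreserving : MeasurePreserving p μ ν
  equivariant : ∀ g : G, ∀ᵐ y ∂μ, p (g • y) = g • p y

/-- `p : (Y, μ) → (Z, ν)` is an isomorphism modulo null sets. -/
def IsIsoModNull {Z : Type*} [MeasurableSpace Z] (μ : Measure Y) (ν : Measure Z)
    (p : Y → Z) : Prop :=
  MeasurePreserving p μ ν ∧ ∃ q : Z → Y, MeasurePreserving q ν μ ∧
    (∀ᵐ y ∂μ, q (p y) = y) ∧ (∀ᵐ z ∂ν, p (q z) = z)

/-- Primeness: there is no non-trivial quotient action. That is, every quotient action on a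
standard Borel probability space `(Z, ν)` is either the one-point action modulo null sets
(`ν` is concentrated at a point), or the action on `(Y, μ)` itself (the quotient map is an
isomorphism modulo null sets). -/
def IsPrimeAction (μ : Measure Y) : Prop :=
  ∀ (Z : Type u) [MeasurableSpace Z] [StandardBorelSpace Z] [MulAction G Z] (ν : Measure Z)
    (p : Y → Z), IsQuotientAction G μ ν p →
      (∃ z₀ : Z, ∀ᵐ z ∂ν, z = z₀) ∨ IsIsoModNull μ ν p

end PMP

/-! ## The action of `PSL₂(ℚ)` on the quotient `Y` of the Pontryagin dual of `ℚ²` -/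

noncomputable section

/-- The discrete abelian group `ℚ²` (a synonym, so as not to get the product topology of `ℚ`). -/
def RatPlane : Type := Fin 2 → ℚ

instance : AddCommGroup RatPlane := inferInstanceAs (AddCommGroup (Fin 2 → ℚ))

instance : TopologicalSpace RatPlane := ⊥

instance : DiscreteTopology RatPlane := ⟨rfl⟩

/-- Left multiplication by `g ∈ SL₂(ℚ)` on `ℚ²`. -/
def RatPlane.act (g : SL(2, ℚ)) (v : RatPlane) : RatPlane :=
  Matrix.mulVec (g : Matrix (Fin 2) (Fin 2) ℚ) v

namespace RatPlane

theorem act_zero (g : SL(2, ℚ)) : act g 0 = 0 := Matrix.mulVec_zero _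

theorem act_add (g : SL(2, ℚ)) (v w : RatPlane) : act g (v + w) = act g v + act g w :=
  Matrix.mulVec_add _ _ _

theorem act_neg (g : SL(2, ℚ)) (v : RatPlane) : act g (-v) = -act g v := Matrix.mulVec_neg _ _

theorem act_one (v : RatPlane) : act 1 v = v := Matrix.one_mulVec _

theorem act_mul (g h : SL(2, ℚ)) (v : RatPlane) : act (g * h) v = act g (act h v) :=
  (Matrix.mulVec_mulVec _ _ _).symm

theorem act_of_mem_center {g : SL(2, ℚ)} (hg : g ∈ Subgroup.center SL(2, ℚ)) :
    (∀ v, act g v = v) ∨ ∀ v, act g v = -v := by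
  rw [Matrix.SpecialLinearGroup.mem_center_iff] at hg
  obtain ⟨r, hr, hg⟩ := hg
  have hact : ∀ (v : RatPlane) (i : Fin 2), act g v i = r * v i := fun v i => by
    
    rw [act, ← hg, Matrix.scalar_apply]
    exact Matrix.mulVec_diagonal (fun _ => r) v i
  rw [Fintype.card_fin] at hr
  rcases sq_eq_one_iff.mp hr with rfl | rfl
  · exact Or.inl fun v => funext fun i => (hact v i).trans (one_mul _)
  · exact Or.inr fun v => funext fun i => (hact v i).trans (neg_one_mul _)

end RatPlane

/-- Left multiplication by `g` as a (continuous) endomorphism of `ℚ²`, written multiplicatively. -/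
def RatPlane.actHom (g : SL(2, ℚ)) : Multiplicative RatPlane →ₜ* Multiplicative RatPlane where
  toFun v := Multiplicative.ofAdd (RatPlane.act g v.toAdd)
  map_one' := congrArg Multiplicative.ofAdd (RatPlane.act_zero g)
  map_mul' v w := congrArg Multiplicative.ofAdd (RatPlane.act_add g v.toAdd w.toAdd)
  continuous_toFun := continuous_of_discreteTopology

/-- The compact group `X`, the Pontryagin dual of the discrete group `ℚ²`. -/
abbrev DualRatPlane : Type := PontryaginDual (Multiplicative RatPlane)

namespace DualRatPlane

/-- The value `⟨χ, v⟩` of the character `χ` at `v ∈ ℚ²`. -/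
def pairing (χ : DualRatPlane) (v : RatPlane) : Circle := χ (Multiplicative.ofAdd v)

instance : MeasurableSpace DualRatPlane := borel DualRatPlane

instance : BorelSpace DualRatPlane := ⟨rfl⟩

/-- The normalized Haar measure of `X`. -/
def haar : Measure DualRatPlane := Measure.haarMeasure ⊤

/-- The algebraic action of `SL₂(ℚ)` on `X`: `⟨g χ, v⟩ = ⟨χ, g⁻¹ v⟩`. -/
instance : MulAction SL(2, ℚ) DualRatPlane where
  smul g χ := PontryaginDual.map (RatPlane.actHom g⁻¹) χ
  one_smul χ := PontryaginDual.ext fun v => by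
    change χ (Multiplicative.ofAdd (RatPlane.act 1⁻¹ v.toAdd)) = χ v
    rw [inv_one, RatPlane.act_one]
    rfl
  mul_smul g h χ := PontryaginDual.ext fun v => by
    change χ (Multiplicative.ofAdd (RatPlane.act (g * h)⁻¹ v.toAdd)) =
      χ (Multiplicative.ofAdd (RatPlane.act h⁻¹ (RatPlane.act g⁻¹ v.toAdd)))
    rw [mul_inv_rev, RatPlane.act_mul]

theorem pairing_smul (g : SL(2, ℚ)) (χ : DualRatPlane) (v : RatPlane) :
    (g • χ).pairing v = χ.pairing (RatPlane.act g⁻¹ v) := rfl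

theorem pairing_ext {χ ψ : DualRatPlane} (h : ∀ v, χ.pairing v = ψ.pairing v) : χ = ψ :=
  PontryaginDual.ext fun v => h v.toAdd

/-- The relation on `X` that identifies `φ` with `φ'`, where `φ' v = φ (-v)`. -/
def flipSetoid : Setoid DualRatPlane where
  r φ ψ := ψ = φ ∨ ∀ v, ψ.pairing v = φ.pairing (-v)
  iseqv :=
    { refl := fun _ => Or.inl rfl
      symm := by
        rintro φ ψ (h | h)
        · exact Or.inl h.symm
        · exact Or.inr fun v => by rw [h, neg_neg]
      trans := by
        rintro φ ψ χ (rfl | h) (rfl | h')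
        · exact Or.inl rfl
        · exact Or.inr h'
        · exact Or.inr h
        · exact Or.inl (pairing_ext fun v => by rw [h', h, neg_neg]) }

end DualRatPlane

/-- The quotient space `Y = X / (φ ∼ φ')`. -/
def FlipQuotient : Type := Quotient DualRatPlane.flipSetoid

namespace FlipQuotient

open DualRatPlane

/-- The quotient map `X → Y`. -/
def mk (χ : DualRatPlane) : FlipQuotient := Quotient.mk flipSetoid χ

/-- `Y` carries the quotient Borel structure: `A ⊆ Y` is measurable iff its preimage in `X` is. -/
instance : MeasurableSpace FlipQuotient := MeasurableSpace.map mk inferInstance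

/-- The probability measure on `Y`: the image of the Haar measure of `X`. -/
def measure : Measure FlipQuotient := DualRatPlane.haar.map mk

/-- The quotient action of `SL₂(ℚ)` on `Y`: `g • mk χ = mk (g • χ)`. -/
instance : MulAction SL(2, ℚ) FlipQuotient where
  smul g := Quotient.map (fun χ => g • χ) (by
    rintro φ ψ (rfl | h)
    · exact Or.inl rfl
    · exact Or.inr fun v => by rw [pairing_smul, pairing_smul, h, RatPlane.act_neg])
  one_smul := by
    rintro ⟨χ⟩
    exact congrArg mk (one_smul _ χ)
  mul_smul g h := by
    rintro ⟨χ⟩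
    exact congrArg mk (mul_smul g h χ)

theorem center_le_ker :
    Subgroup.center SL(2, ℚ) ≤ (MulAction.toPermHom SL(2, ℚ) FlipQuotient).ker := by
  intro g hg
  rw [MonoidHom.mem_ker]
  ext y
  obtain ⟨χ⟩ := y
  refine Quotient.sound (s := flipSetoid) ?_
  rcases RatPlane.act_of_mem_center (inv_mem hg) with h | h
  · exact Or.inl (pairing_ext fun v => by rw [pairing_smul, h])
  · exact Or.inr fun v => by rw [pairing_smul, h, neg_neg]

/-- The action of `PSL₂(ℚ) = SL₂(ℚ) / {±1}` on `Y` induced by that of `SL₂(ℚ)`. -/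
instance : MulAction PSL(2, ℚ) FlipQuotient :=
  MulAction.compHom FlipQuotient
    (QuotientGroup.lift (Subgroup.center SL(2, ℚ)) (MulAction.toPermHom SL(2, ℚ) FlipQuotient)
      center_le_ker)

theorem psl_smul_mk (g : SL(2, ℚ)) (χ : DualRatPlane) :
    (QuotientGroup.mk g : PSL(2, ℚ)) • mk χ = mk (g • χ) := rfl

end FlipQuotient

end

/-!
The characters `e_v : χ ↦ χ v`, `v ∈ ℚ²`, form a Hilbert basis of `L²(X)` which `SL₂(ℚ)` permutes
as it permutes the vectors. Weak mixing holds because the diagonal matrices with entries `2ⁿ`,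
`2⁻ⁿ` push every `v ≠ 0` to infinity, and freeness because `{χ | χ v = 1}` is a null set for
`v ≠ 0`.

For primeness, let `E` be the conditional expectation onto a quotient of `Y`, pulled back to `X`.
It commutes with `SL₂(ℚ)`, and the stabilizer of `v ≠ 0` has infinite orbits off `ℚv`, so by
square-summability `E e_v = ∑ₓ c(x) e_{xv}`, with `c` independent of `v` since `SL₂(ℚ)` is
transitive on the non-zero vectors. Comparing coefficients in `E(E(e_v) e_w) = E(e_v) E(e_w)` for
independent `v`, `w` yields `c(y) c(x / y) = c(x) c(y)`. If `c(y) ≠ 0` then `c` is invariant under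
division by `y`, which is compatible with square-summability only for `y = ± 1`. By invariance
under the flip, `E e_v = c(1) (e_v + e_{-v})`. If `c(1) = 0`, the quotient is trivial. Otherwise
all functions `Re e_v` factor through it, and these separate the points of `Y`.
-/

noncomputable section

open Filter Topology ComplexConjugate

theorem measurableEq_of_countablySeparated {Z : Type*} [MeasurableSpace Z]
    [MeasurableSpace.CountablySeparated Z] : MeasurableEq Z := by
  obtain ⟨f, hf, hinj⟩ := MeasurableSpace.measurable_injection_nat_bool_of_countablySeparated Z
  refine ⟨?_⟩
  simpa only [Set.diagonal, Function.comp_apply, hinj.eq_iff] using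
    measurableSet_eq_fun (hf.comp measurable_fst) (hf.comp measurable_snd)

section GroupActions

variable {G Y : Type*} [Group G] [MulAction G Y] [MeasurableSpace Y] {μ : Measure Y}

theorem isWeaklyMixingAction_of_tendsto {ι : Type*} {l : Filter ι} [l.NeBot] (s : ι → G)
    (hs : ∀ A B : Set Y, MeasurableSet A → MeasurableSet B →
      Tendsto (fun i => μ.real ((fun y => (s i)⁻¹ • y) ⁻¹' A ∩ B)) l (𝓝 (μ.real A * μ.real B))) :
    IsWeaklyMixingAction G μ := by
  intro Ω hΩ hmeas ε hε
  have hpair : ∀ A ∈ Ω, ∀ B ∈ Ω, ∀ᶠ i in l,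
      |μ.real (((fun y : Y => s i • y) '' A) ∩ B) - μ.real A * μ.real B| < ε := by
    intro A hA B hB
    filter_upwards [Metric.tendsto_nhds.1 (hs A B (hmeas A hA) (hmeas B hB)) ε hε] with i hi
    rwa [Set.image_eq_preimage_of_inverse (inv_smul_smul (s i)) (smul_inv_smul (s i))]
  obtain ⟨i, hi⟩ :=
    ((hΩ.eventually_all (l := l)).2 fun A hA => (hΩ.eventually_all (l := l)).2 (hpair A hA)).exists
  exact ⟨s i, hi⟩

theorem IsPMPAction.measurableEmbedding_smul (hμ : IsPMPAction G μ) (g : G) :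
    MeasurableEmbedding fun y : Y => g • y :=
  MeasurableEquiv.measurableEmbedding
    { MulAction.toPerm g with
      measurable_toFun := (hμ.measurePreserving g).measurable
      measurable_invFun := (hμ.measurePreserving g⁻¹).measurable }

theorem IsQuotientAction.condExp_comp_smul {Z : Type*} [MulAction G Z] [mZ : MeasurableSpace Z]
    {ν : Measure Z} {p : Y → Z} (hp : IsQuotientAction G μ ν p) (hμ : IsPMPAction G μ)
    {E : Type*} [NormedAddCommGroup E] [NormedSpace ℝ E] [CompleteSpace E] {f : Y → E}
    (hf : Integrable f μ) (g : G) :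
    (fun y => (μ[f | mZ.comap p]) (g • y)) =ᵐ[μ] μ[fun y => f (g • y) | mZ.comap p] := by
  have := hμ.isProbabilityMeasure
  have hle := hp.measurePreserving.measurable.comap_le
  have hg := hμ.measurePreserving g
  refine ae_eq_condExp_of_forall_setIntegral_eq hle (hg.integrable_comp_of_integrable hf)
    (fun s _ _ => (hg.integrable_comp_of_integrable integrable_condExp).integrableOn) ?_ ?_
  · rintro - ⟨B, hB, rfl⟩ -
    have hBg : MeasurableSet ((fun z => g⁻¹ • z) ⁻¹' B) :=
      (hp.isPMPAction.measurePreserving g⁻¹).measurable hB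
    have hshift : p ⁻¹' B = (fun y => g • y) ⁻¹' ((fun y => g⁻¹ • y) ⁻¹' (p ⁻¹' B)) := by
      ext y
      simp only [Set.mem_preimage, inv_smul_smul]
    have hae : (fun y => g⁻¹ • y) ⁻¹' (p ⁻¹' B) =ᵐ[μ] p ⁻¹' ((fun z => g⁻¹ • z) ⁻¹' B) := by
      filter_upwards [hp.equivariant g⁻¹] with y hy
      exact congrArg (· ∈ B) hy
    rw [hshift, hg.setIntegral_preimage_emb (hμ.measurableEmbedding_smul g),
      hg.setIntegral_preimage_emb (hμ.measurableEmbedding_smul g), setIntegral_congr_set hae,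
      setIntegral_congr_set hae]
    exact setIntegral_condExp hle hf ⟨_, hBg, rfl⟩
  · obtain ⟨h, hh, hhp⟩ :=
      (stronglyMeasurable_condExp (μ := μ) (f := f) (m := mZ.comap p)).exists_eq_measurable_comp
    refine ⟨(h ∘ (g • ·)) ∘ p, (hh.comp_measurable
      (hp.isPMPAction.measurePreserving g).measurable).comp_measurable (comap_measurable p), ?_⟩
    filter_upwards [hp.equivariant g] with y hy
    rw [hhp, Function.comp_apply, hy]
    rfl

theorem isIsoModNull_of_comp_ae_eq {Z W : Type*} [MeasurableSpace Z] [MeasurableEq Z]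
    [MeasurableSpace W] [Nonempty Y] {ν : Measure Z} {p : Y → Z} (hp : MeasurePreserving p μ ν)
    {F : Y → W} (hF : MeasurableEmbedding F) {h : Z → W} (hh : Measurable h)
    (hhp : h ∘ p =ᵐ[μ] F) : IsIsoModNull μ ν p := by
  obtain ⟨r, hr, hrF⟩ := hF.exists_measurable_extend measurable_id fun _ => inferInstance
  have hq : Measurable (r ∘ h) := hr.comp hh
  have hqp : ∀ᵐ y ∂μ, (r ∘ h) (p y) = y := by
    filter_upwards [hhp] with y hy
    exact (congrArg r hy).trans (congrFun hrF y)
  have hpq : ∀ᵐ z ∂ν, p ((r ∘ h) z) = z := by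
    rw [← hp.map_eq]
    refine (ae_map_iff hp.measurable.aemeasurable
      (measurableSet_eq_fun (hp.measurable.comp hq) measurable_id)).2 ?_
    filter_upwards [hqp] with y hy
    exact congrArg p hy
  have hmap : ν.map (r ∘ h) = μ := by
    rw [← hp.map_eq, Measure.map_map hq hp.measurable]
    exact (Measure.map_congr hqp).trans Measure.map_id
  exact ⟨hp, r ∘ h, ⟨hq, hmap⟩, hqp, hpq⟩

end GroupActions

theorem integral_inner_condExp_left_eq_right {Ω 𝕜 E : Type*} [RCLike 𝕜] [NormedAddCommGroup E]
    [InnerProductSpace 𝕜 E] [InnerProductSpace ℝ E] [CompleteSpace E] {m m₀ : MeasurableSpace Ω}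
    {μ : Measure Ω} [IsFiniteMeasure μ] (hm : m ≤ m₀) {f g : Ω → E} (hf : MemLp f 2 μ)
    (hg : MemLp g 2 μ) :
    ∫ x, inner 𝕜 ((μ[f | m]) x) (g x) ∂μ = ∫ x, inner 𝕜 (f x) ((μ[g | m]) x) ∂μ := by
  have h := inner_condExpL2_left_eq_right (𝕜 := 𝕜) hm (f := hf.toLp f) (g := hg.toLp g)
  rw [L2.inner_def, L2.inner_def] at h
  refine (integral_congr_ae ?_).trans (h.trans (integral_congr_ae ?_))
  · filter_upwards [hf.condExpL2_ae_eq_condExp (𝕜 := 𝕜) hm, hg.coeFn_toLp] with x hfx hgx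
    rw [hfx, hgx]
  · filter_upwards [hg.condExpL2_ae_eq_condExp (𝕜 := 𝕜) hm, hf.coeFn_toLp] with x hgx hfx
    rw [hfx, hgx]

theorem tendsto_apply_of_tendsto_of_span_dense {ι 𝕜 E F : Type*} [NontriviallyNormedField 𝕜]
    [SeminormedAddCommGroup E] [NormedSpace 𝕜 E] [SeminormedAddCommGroup F] [NormedSpace 𝕜 F]
    {l : Filter ι} {T : ι → E →L[𝕜] F} {T₀ : E →L[𝕜] F} {C : ℝ} (hC : ∀ i, ‖T i‖ ≤ C) {s : Set E}
    (hs : (Submodule.span 𝕜 s).topologicalClosure = ⊤)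
    (h : ∀ x ∈ s, Tendsto (T · x) l (𝓝 (T₀ x))) (x : E) : Tendsto (T · x) l (𝓝 (T₀ x)) := by
  have hspan : (Submodule.span 𝕜 s : Set E) ⊆ {x | Tendsto (T · x) l (𝓝 (T₀ x))} := by
    intro x hx
    change Tendsto (T · x) l (𝓝 (T₀ x))
    induction hx using Submodule.span_induction with
    | mem x hx => exact h x hx
    | zero => simpa only [map_zero] using tendsto_const_nhds
    | add x y _ _ hx hy => simpa only [map_add] using hx.add hy
    | smul c x _ hx => simpa only [map_smul] using hx.const_smul c
  have hequi : Equicontinuous fun i => ⇑(T i) :=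
    ((NormedSpace.equicontinuous_TFAE T).out 1 5 : _ ↔ ∃ C, ∀ i, ‖T i‖ ≤ C).2 ⟨C, hC⟩
  have hclosed : IsClosed {x | Tendsto (T · x) l (𝓝 (T₀ x))} :=
    hequi.isClosed_setOfPred_tendsto T₀.continuous
  have hx : x ∈ (Submodule.span 𝕜 s).topologicalClosure := hs ▸ Submodule.mem_top
  exact closure_minimal hspan hclosed hx

theorem inner_toLp_toLp {Ω 𝕜 : Type*} [RCLike 𝕜] {m : MeasurableSpace Ω} {μ : Measure Ω}
    {f g : Ω → 𝕜} (hf : MemLp f 2 μ) (hg : MemLp g 2 μ) :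
    inner 𝕜 (hf.toLp f) (hg.toLp g) = ∫ x, conj (f x) * g x ∂μ := by
  rw [L2.inner_def]
  refine integral_congr_ae ?_
  filter_upwards [hf.coeFn_toLp, hg.coeFn_toLp] with x hfx hgx
  rw [hfx, hgx, RCLike.inner_apply']

theorem exists_injective_addCircle_rat_to_addCircle_real :
    ∃ φ : AddCircle (1 : ℚ) →+ AddCircle (1 : ℝ), Function.Injective φ := by
  have hcast (q : ℚ) : ((q : ℝ) ∈ AddSubgroup.zmultiples (1 : ℝ)) ↔
      q ∈ AddSubgroup.zmultiples (1 : ℚ) := by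
    simp only [AddSubgroup.mem_zmultiples_iff, zsmul_one]
    exact_mod_cast Iff.rfl
  refine ⟨QuotientAddGroup.map _ _ (Rat.castHom ℝ).toAddMonoidHom fun q hq => (hcast q).2 hq,
    (injective_iff_map_eq_zero _).2 fun x hx => ?_⟩
  obtain ⟨q, rfl⟩ := QuotientAddGroup.mk_surjective x
  exact (QuotientAddGroup.eq_zero_iff q).2
    ((hcast q).1 ((QuotientAddGroup.eq_zero_iff (q : ℝ)).1 hx))

theorem exists_addChar_circle_apply_ne_one {A : Type*} [AddCommGroup A] {a : A} (ha : a ≠ 0) :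
    ∃ ψ : AddChar A Circle, ψ a ≠ 1 := by
  obtain ⟨c, hc⟩ := CharacterModule.exists_character_apply_ne_zero_of_ne_zero ha
  obtain ⟨φ, hφ⟩ := exists_injective_addCircle_rat_to_addCircle_real
  refine ⟨AddCircle.toCircle_addChar.compAddMonoidHom (φ.comp c), fun h => hc ?_⟩
  refine hφ (AddCircle.injective_toCircle one_ne_zero ?_)
  rw [map_zero, AddCircle.toCircle_zero]
  exact h

theorem circle_eq_or_eq_inv_of_re_eq {z w : Circle} (h : (z : ℂ).re = (w : ℂ).re) :
    z = w ∨ z = w⁻¹ := by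
  have hz : (z : ℂ) * conj (z : ℂ) = 1 := by rw [Complex.mul_conj, Circle.normSq_coe]; rfl
  have hw : (w : ℂ) * conj (w : ℂ) = 1 := by rw [Complex.mul_conj, Circle.normSq_coe]; rfl
  have hsum : (z : ℂ) + conj (z : ℂ) = w + conj (w : ℂ) := by
    rw [Complex.add_conj, Complex.add_conj, h]
  have hprod : ((z : ℂ) - w) * (z - conj (w : ℂ)) = 0 := by
    linear_combination z * hsum - hz + hw
  rcases mul_eq_zero.1 hprod with heq | heq
  · exact .inl (Circle.ext (sub_eq_zero.1 heq))
  · exact .inr (Circle.ext ((sub_eq_zero.1 heq).trans (Circle.coe_inv_eq_conj w).symm))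

/-- The Pontryagin dual of an additively written abelian group, on which we do Fourier analysis
when the group is discrete. -/
abbrev DiscreteDual (A : Type*) [AddCommGroup A] [TopologicalSpace A] : Type _ :=
  PontryaginDual (Multiplicative A)

namespace DiscreteDual

variable {A : Type*} [AddCommGroup A] [TopologicalSpace A]

section Characters

/-- The character `χ ↦ χ a` of the dual group given by evaluation at `a`, as a complex-valued
continuous function. -/
def char (a : A) : C(DiscreteDual A, ℂ) where
  toFun χ := (χ (Multiplicative.ofAdd a) : ℂ)
  continuous_toFun := continuous_subtype_val.comp
    ((ContinuousEvalConst.continuous_eval_const (F := C(Multiplicative A, Circle))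
      (Multiplicative.ofAdd a)).comp
      (ContinuousMonoidHom.isInducing_toContinuousMap (Multiplicative A) Circle).continuous)

theorem char_apply (a : A) (χ : DiscreteDual A) :
    char a χ = (χ (Multiplicative.ofAdd a) : ℂ) := rfl

theorem ext_char {χ ψ : DiscreteDual A} (h : ∀ a, char a χ = char a ψ) : χ = ψ :=
  PontryaginDual.ext fun a => Circle.coe_injective (h a.toAdd)

theorem norm_char_apply (a : A) (χ : DiscreteDual A) : ‖char a χ‖ = 1 := Circle.norm_coe _

theorem char_zero : char (0 : A) = 1 := by
  ext χ
  exact congrArg Circle.coeHom (map_one χ)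

theorem char_add (a b : A) : char (a + b) = char a * char b := by
  ext χ
  exact congrArg Circle.coeHom (map_mul χ (Multiplicative.ofAdd a) (Multiplicative.ofAdd b))

theorem char_neg (a : A) : char (-a) = star (char a) := by
  ext χ
  rw [char_apply, ofAdd_neg, map_inv, Circle.coe_inv_eq_conj]
  rfl

theorem conj_char_apply (a : A) (χ : DiscreteDual A) : conj (char a χ) = char (-a) χ := by
  rw [char_neg]
  rfl

theorem char_sub_apply (a b : A) (χ : DiscreteDual A) :
    char (a - b) χ = char a χ * conj (char b χ) := by
  rw [sub_eq_add_neg, char_add, ContinuousMap.mul_apply, conj_char_apply]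

theorem char_nsmul_apply (n : ℕ) (a : A) (χ : DiscreteDual A) :
    char (n • a) χ = char a χ ^ n := by
  rw [char_apply, ofAdd_nsmul, map_pow, Circle.coe_pow, char_apply]

theorem char_inv_apply (a : A) (χ : DiscreteDual A) : char a χ⁻¹ = char (-a) χ := by
  rw [char_apply, char_apply, ofAdd_neg, map_inv]
  rfl

theorem eq_or_eq_inv_of_re_char_eq {χ ψ : DiscreteDual A}
    (h : ∀ a, (char a χ).re = (char a ψ).re) : χ = ψ ∨ χ = ψ⁻¹ := by
  have hcover : ((⊤ : Subgroup (Multiplicative A)) : Set (Multiplicative A)) ⊆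
      (χ : Multiplicative A →* Circle).eqLocus (ψ : Multiplicative A →* Circle) ∪
        (χ : Multiplicative A →* Circle).eqLocus (ψ⁻¹ : DiscreteDual A) :=
    fun a _ => circle_eq_or_eq_inv_of_re_eq (h a.toAdd)
  exact (SubgroupClass.subset_union.1 hcover).imp
    (fun hle => PontryaginDual.ext fun _ => hle trivial)
    fun hle => PontryaginDual.ext fun _ => hle trivial

theorem exists_char_apply_ne_one [DiscreteTopology A] {a : A} (ha : a ≠ 0) :
    ∃ χ : DiscreteDual A, char a χ ≠ 1 := by
  obtain ⟨ψ, hψ⟩ := exists_addChar_circle_apply_ne_one ha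
  exact ⟨⟨ψ.toMonoidHom, continuous_of_discreteTopology⟩, fun h => hψ (Circle.coe_eq_one.1 h)⟩

theorem span_range_char_topologicalClosure [DiscreteTopology A] :
    (Submodule.span ℂ (Set.range (char (A := A)))).topologicalClosure = ⊤ := by
  let S : StarSubalgebra ℂ C(DiscreteDual A, ℂ) :=
    { Algebra.adjoin ℂ (Set.range char) with
      star_mem' := by
        change Algebra.adjoin ℂ (Set.range char) ≤ star (Algebra.adjoin ℂ (Set.range char))
        refine Algebra.adjoin_le ?_
        rintro - ⟨a, rfl⟩
        exact Algebra.subset_adjoin ⟨-a, char_neg a⟩ }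
  have hsep : S.SeparatesPoints := by
    intro χ ψ hne
    obtain ⟨a, ha⟩ := not_forall.1 (mt ext_char hne)
    exact ⟨_, ⟨char a, Algebra.subset_adjoin ⟨a, rfl⟩, rfl⟩, ha⟩
  have hspan : Subalgebra.toSubmodule S.toSubalgebra = Submodule.span ℂ (Set.range char) := by
    refine Algebra.adjoin_eq_span_of_subset ℂ
      (Set.Subset.trans (fun f hf => ?_) Submodule.subset_span)
    induction hf using Submonoid.closure_induction with
    | mem _ hf => exact hf
    | one => exact ⟨0, char_zero⟩
    | mul f g _ _ hf hg =>
      obtain ⟨⟨a, rfl⟩, ⟨b, rfl⟩⟩ := And.intro hf hg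
      exact ⟨a + b, char_add a b⟩
  rw [← hspan]
  exact congrArg (Subalgebra.toSubmodule <| StarSubalgebra.toSubalgebra ·)
    (ContinuousMap.starSubalgebra_topologicalClosure_eq_top_of_separatesPoints S hsep)

end Characters

section Haar

variable [DiscreteTopology A] [MeasurableSpace (DiscreteDual A)] [BorelSpace (DiscreteDual A)]
  (μ : Measure (DiscreteDual A)) [μ.IsMulLeftInvariant]

theorem integral_char_eq_zero {a : A} (ha : a ≠ 0) : ∫ χ, char a χ ∂μ = 0 := by
  obtain ⟨ψ, hψ⟩ := exists_char_apply_ne_one ha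
  have htranslate : char a ψ * ∫ χ, char a χ ∂μ = ∫ χ, char a χ ∂μ := by
    rw [← integral_const_mul]
    exact integral_mul_left_eq_self (fun χ => char a χ) ψ
  by_contra hint
  exact hψ ((mul_eq_right₀ hint).1 htranslate)

end Haar

section Fourier

variable [MeasurableSpace (DiscreteDual A)] (μ : Measure (DiscreteDual A))

/-- The Fourier coefficient `∫ conj (χ a) f(χ) dμ(χ)` of a function on the dual group. -/
def coeff (f : DiscreteDual A → ℂ) (a : A) : ℂ := ∫ χ, conj (char a χ) * f χ ∂μ

theorem coeff_congr_ae {f g : DiscreteDual A → ℂ} (h : f =ᵐ[μ] g) : coeff μ f = coeff μ g := by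
  ext a
  refine integral_congr_ae ?_
  filter_upwards [h] with χ hχ
  rw [hχ]

theorem coeff_zero_right (f : DiscreteDual A → ℂ) : coeff μ f 0 = ∫ χ, f χ ∂μ := by
  simp only [coeff, char_zero, ContinuousMap.one_apply, map_one, one_mul]

theorem coeff_const_mul (c : ℂ) (f : DiscreteDual A → ℂ) (a : A) :
    coeff μ (fun χ => c * f χ) a = c * coeff μ f a := by
  simp only [coeff, mul_left_comm _ c, integral_const_mul]

theorem coeff_mul_char (f : DiscreteDual A → ℂ) (b a : A) :
    coeff μ (fun χ => f χ * char b χ) a = coeff μ f (a - b) := by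
  simp only [coeff, char_sub_apply, map_mul, Complex.conj_conj, mul_assoc, mul_comm (f _)]

theorem conj_coeff (f : DiscreteDual A → ℂ) (a : A) :
    conj (coeff μ f a) = coeff μ (fun χ => conj (f χ)) (-a) := by
  simp only [coeff, ← integral_conj, map_mul, conj_char_apply]

variable [BorelSpace (DiscreteDual A)]

theorem coeff_neg_of_comp_inv [μ.IsInvInvariant] {f : DiscreteDual A → ℂ}
    (hf : ∀ χ, f χ⁻¹ = f χ) (a : A) : coeff μ f (-a) = coeff μ f a := by
  rw [coeff, coeff, ← integral_inv_eq_self]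
  simp only [hf, char_inv_apply, neg_neg]

theorem memLp_char [IsFiniteMeasure μ] (a : A) (p : ENNReal) : MemLp (char a) p μ :=
  MemLp.of_bound (char a).continuous.aestronglyMeasurable 1
    (ae_of_all _ fun χ => (norm_char_apply a χ).le)

variable [DiscreteTopology A]

theorem span_range_toLp_char_topologicalClosure [IsFiniteMeasure μ] [μ.WeaklyRegular] :
    (Submodule.span ℂ (Set.range fun a : A =>
      (memLp_char μ a 2).toLp (char a))).topologicalClosure = ⊤ := by
  have hdense := (ContinuousMap.toLp_denseRange ℂ μ ℂ
    (ENNReal.ofNat_ne_top (n := 2))).topologicalClosure_map_submodule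
      (span_range_char_topologicalClosure (A := A))
  rw [Submodule.map_span, ← Set.range_comp] at hdense
  exact hdense

variable [IsProbabilityMeasure μ] [μ.IsMulLeftInvariant]

theorem orthonormal_toLp_char :
    Orthonormal ℂ fun a : A => (memLp_char μ a 2).toLp (char a) := by
  classical
  rw [orthonormal_iff_ite]
  intro a b
  rw [inner_toLp_toLp]
  simp only [mul_comm (conj _), ← char_sub_apply]
  split_ifs with hab
  · simp only [hab, sub_self, char_zero, ContinuousMap.one_apply, integral_const, probReal_univ,
      one_smul]
  · exact integral_char_eq_zero μ (sub_ne_zero.2 (Ne.symm hab))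

variable [μ.WeaklyRegular]

/-- The Hilbert basis of `L²` of the dual group that consists of the characters. -/
def charBasis : HilbertBasis A ℂ (Lp ℂ 2 μ) :=
  HilbertBasis.mk (orthonormal_toLp_char μ) (span_range_toLp_char_topologicalClosure μ).ge

theorem charBasis_apply (a : A) : charBasis μ a = (memLp_char μ a 2).toLp (char a) :=
  congrFun (HilbertBasis.coe_mk _ _) a

theorem inner_charBasis_toLp {f : DiscreteDual A → ℂ} (hf : MemLp f 2 μ) (a : A) :
    inner ℂ (charBasis μ a) (hf.toLp f) = coeff μ f a := by
  rw [charBasis_apply, inner_toLp_toLp]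
  rfl

theorem coeff_add {f g : DiscreteDual A → ℂ} (hf : MemLp f 2 μ) (hg : MemLp g 2 μ) (a : A) :
    coeff μ (f + g) a = coeff μ f a + coeff μ g a := by
  rw [← inner_charBasis_toLp μ (hf.add hg), MemLp.toLp_add hf hg, inner_add_right,
    inner_charBasis_toLp, inner_charBasis_toLp]

theorem coeff_char (a b : A) [Decidable (b = a)] :
    coeff μ (char a) b = if b = a then 1 else 0 := by
  classical
  rw [← inner_charBasis_toLp μ (memLp_char μ a 2), ← charBasis_apply,
    orthonormal_iff_ite.1 (charBasis μ).orthonormal]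
  congr

theorem hasSum_conj_coeff_mul_coeff {f g : DiscreteDual A → ℂ} (hf : MemLp f 2 μ)
    (hg : MemLp g 2 μ) :
    HasSum (fun a => conj (coeff μ f a) * coeff μ g a) (∫ χ, conj (f χ) * g χ ∂μ) := by
  rw [← inner_toLp_toLp hf hg]
  simpa only [inner_charBasis_toLp, ← inner_conj_symm (hf.toLp f)] using
    (charBasis μ).hasSum_inner_mul_inner (hf.toLp f) (hg.toLp g)

theorem ae_eq_of_coeff_eq {f g : DiscreteDual A → ℂ} (hf : MemLp f 2 μ) (hg : MemLp g 2 μ)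
    (h : ∀ a, coeff μ f a = coeff μ g a) : f =ᵐ[μ] g := by
  rw [← MemLp.toLp_eq_toLp_iff hf hg]
  refine (charBasis μ).repr.injective (lp.ext (funext fun a => ?_))
  rw [HilbertBasis.repr_apply_apply, HilbertBasis.repr_apply_apply, inner_charBasis_toLp,
    inner_charBasis_toLp, h]

theorem tendsto_coeff_cofinite {f : DiscreteDual A → ℂ} (hf : MemLp f 2 μ) :
    Tendsto (coeff μ f) cofinite (𝓝 0) := by
  have h := (hasSum_conj_coeff_mul_coeff μ hf hf).summable.tendsto_cofinite_zero
  simp only [Complex.conj_mul'] at h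
  rw [tendsto_zero_iff_norm_tendsto_zero]
  have h2 := h.norm.sqrt
  simpa using h2

theorem hasSum_coeff_sub_mul_coeff {f g : DiscreteDual A → ℂ} (hf : MemLp f 2 μ)
    (hg : MemLp g 2 μ) (a : A) :
    HasSum (fun b => coeff μ f (a - b) * coeff μ g b) (coeff μ (fun χ => f χ * g χ) a) := by
  have hF : MemLp (fun χ => conj (f χ) * char a χ) 2 μ := MemLp.mul' (memLp_char μ a ⊤) hf.star
  have h := hasSum_conj_coeff_mul_coeff μ hF hg
  simp only [coeff_mul_char, conj_coeff, map_mul, Complex.conj_conj, neg_sub] at h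
  simpa only [coeff, mul_left_comm (conj (char a _)), mul_assoc] using h

theorem eq_zero_of_forall_coeff_eq {ι : Type*} [Infinite ι] {f : DiscreteDual A → ℂ}
    (hf : MemLp f 2 μ) {a : ι → A} (ha : Function.Injective a) {c : ℂ}
    (hc : ∀ i, coeff μ f (a i) = c) : c = 0 := by
  have h := (tendsto_coeff_cofinite μ hf).comp ha.tendsto_cofinite
  simp only [Function.comp_def, hc] at h
  exact tendsto_nhds_unique tendsto_const_nhds h

theorem measure_setOf_char_eq_one {a : A} (ha : ¬ IsOfFinAddOrder a) :
    μ {χ | char a χ = 1} = 0 := by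
  have hS : MeasurableSet {χ | char a χ = 1} :=
    measurableSet_eq_fun (char a).continuous.measurable measurable_const
  have hcoeff (n : ℕ) : coeff μ ({χ | char a χ = 1}.indicator 1) (n • a) =
      μ.real {χ | char a χ = 1} := by
    rw [coeff, ← integral_indicator_one hS, ← integral_complex_ofReal]
    refine integral_congr_ae (ae_of_all _ fun χ => ?_)
    by_cases hχ : char a χ = 1
    · simp [hχ, char_nsmul_apply]
    · simp [hχ]
  have hreal := eq_zero_of_forall_coeff_eq μ ((memLp_const 1).indicator hS)
    (injective_nsmul_iff_not_isOfFinAddOrder.2 ha) hcoeff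
  exact (measureReal_eq_zero_iff).1 (Complex.ofReal_eq_zero.1 hreal)

theorem ae_exists_char_ne [IsAddTorsionFree A] {ι : Type*} {φ ψ : ι → A} (h : φ ≠ ψ) :
    ∀ᵐ χ ∂μ, ∃ i, char (φ i) χ ≠ char (ψ i) χ := by
  obtain ⟨i, hi⟩ := Function.ne_iff.1 h
  have hnull := measure_setOf_char_eq_one μ
    (not_isOfFinAddOrder_of_isAddTorsionFree (sub_ne_zero.2 hi))
  filter_upwards [measure_eq_zero_iff_ae_notMem.1 hnull] with χ hχ
  refine ⟨i, fun hi => hχ ?_⟩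
  rw [char_sub_apply, hi, Complex.mul_conj', norm_char_apply, Complex.ofReal_one, one_pow]

theorem charBasis_zero :
    charBasis μ 0 = indicatorConstLp 2 MeasurableSet.univ (measure_ne_top μ Set.univ) 1 := by
  rw [charBasis_apply, indicatorConstLp]
  congr 1
  rw [char_zero, Set.indicator_univ]
  rfl

theorem tendsto_inner_charBasis_cofinite (x : Lp ℂ 2 μ) :
    Tendsto (fun a => inner ℂ x (charBasis μ a)) cofinite (𝓝 0) := by
  have hinner (a : A) : inner ℂ x (charBasis μ a) = conj (coeff μ x a) := by
    rw [← inner_charBasis_toLp μ (Lp.memLp x), Lp.toLp_coeFn, inner_conj_symm]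
  simpa only [hinner, map_zero, Function.comp_def] using
    (Complex.continuous_conj.tendsto 0).comp (tendsto_coeff_cofinite μ (Lp.memLp x))

section Mixing

variable {ι : Type*} {l : Filter ι} {T : ι → DiscreteDual A → DiscreteDual A} {σ : ι → A → A}
  (hT : ∀ i, MeasurePreserving (T i) μ μ) (hσ : ∀ i a χ, char a (T i χ) = char (σ i a) χ)
  (hlim : ∀ a ≠ 0, Tendsto (σ · a) l cofinite)

include hT hσ hlim

theorem tendsto_inner_compMeasurePreserving (x y : Lp ℂ 2 μ) :
    Tendsto (fun i => inner ℂ x (Lp.compMeasurePreserving (T i) (hT i) y)) l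
      (𝓝 (inner ℂ x (charBasis μ 0) * inner ℂ (charBasis μ 0) y)) := by
  have hcomp (i : ι) (a : A) : Lp.compMeasurePreserving (T i) (hT i) (charBasis μ a) =
      charBasis μ (σ i a) := by
    rw [charBasis_apply, charBasis_apply, Lp.toLp_compMeasurePreserving]
    congr 1
    exact funext (hσ i a)
  let U (i : ι) : Lp ℂ 2 μ →L[ℂ] ℂ :=
    innerSL ℂ x ∘L (Lp.compMeasurePreservingₗᵢ ℂ (T i) (hT i)).toContinuousLinearMap
  have hnorm (i : ι) : ‖U i‖ ≤ ‖x‖ := by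
    refine (ContinuousLinearMap.opNorm_comp_le _ _).trans ?_
    rw [innerSL_apply_norm]
    exact mul_le_of_le_one_right (norm_nonneg x) (LinearIsometry.norm_toContinuousLinearMap_le _)
  refine tendsto_apply_of_tendsto_of_span_dense (T := U)
    (T₀ := inner ℂ x (charBasis μ 0) • innerSL ℂ (charBasis μ 0)) hnorm
    (charBasis μ).dense_span ?_ y
  rintro - ⟨a, rfl⟩
  change Tendsto (fun i => inner ℂ x (Lp.compMeasurePreserving (T i) (hT i) (charBasis μ a))) l
    (𝓝 (inner ℂ x (charBasis μ 0) * inner ℂ (charBasis μ 0) (charBasis μ a)))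
  rcases eq_or_ne a 0 with rfl | ha
  · have hfix (i : ι) : Lp.compMeasurePreserving (T i) (hT i) (charBasis μ 0) = charBasis μ 0 := by
      rw [charBasis_zero]
      rfl
    rw [inner_self_eq_norm_sq_to_K, (charBasis μ).orthonormal.norm_eq_one]
    simpa only [hfix, RCLike.ofReal_one, one_pow, mul_one] using tendsto_const_nhds
  · simp only [hcomp, (charBasis μ).orthonormal.inner_eq_zero ha.symm, mul_zero]
    exact (tendsto_inner_charBasis_cofinite μ x).comp (hlim a ha)

theorem tendsto_measureReal_preimage_inter {S S' : Set (DiscreteDual A)} (hS : MeasurableSet S)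
    (hS' : MeasurableSet S') :
    Tendsto (fun i => μ.real (T i ⁻¹' S ∩ S')) l (𝓝 (μ.real S * μ.real S')) := by
  have h := tendsto_inner_compMeasurePreserving μ hT hσ hlim
    (indicatorConstLp 2 hS' (measure_ne_top μ S') 1) (indicatorConstLp 2 hS (measure_ne_top μ S) 1)
  simp only [charBasis_zero, Lp.indicatorConstLp_compMeasurePreserving,
    L2.inner_indicatorConstLp_one_indicatorConstLp_one, Set.inter_univ, Set.univ_inter] at h
  simp only [mul_comm (μ.real S), Set.inter_comm _ S']
  exact_mod_cast (Complex.continuous_re.tendsto _).comp h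

end Mixing

end Fourier

section CondExp

variable (m : MeasurableSpace (DiscreteDual A)) [m₀ : MeasurableSpace (DiscreteDual A)]
  (μ : Measure (DiscreteDual A))

/-- The matrix coefficients, in the Hilbert basis of characters, of the conditional expectation
onto `m`: the Fourier coefficient at `b` of the conditional expectation of the character `a`. -/
def condCoeff (a b : A) : ℂ := coeff μ (μ[char a | m]) b

variable [BorelSpace (DiscreteDual A)] [IsProbabilityMeasure μ] {m} {μ} (hm : m ≤ m₀)

include hm

theorem coeff_condExp_eq_integral {f : DiscreteDual A → ℂ} (hf : MemLp f 2 μ) (a : A) :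
    coeff μ (μ[f | m]) a = ∫ χ, conj ((μ[char a | m]) χ) * f χ ∂μ := by
  simpa only [coeff, RCLike.inner_apply'] using
    (integral_inner_condExp_left_eq_right (𝕜 := ℂ) hm (memLp_char μ a 2) hf).symm

theorem conj_condCoeff (a b : A) : conj (condCoeff m μ a b) = condCoeff m μ b a := by
  rw [condCoeff, condCoeff, coeff_condExp_eq_integral hm (memLp_char μ b 2), coeff, ← integral_conj]
  simp only [map_mul, Complex.conj_conj, mul_comm]

variable [DiscreteTopology A] [μ.IsMulLeftInvariant]

theorem condCoeff_zero_right {a : A} (ha : a ≠ 0) : condCoeff m μ a 0 = 0 := by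
  rw [condCoeff, coeff_zero_right, integral_condExp hm, integral_char_eq_zero μ ha]

variable [μ.WeaklyRegular]

omit hm in
theorem eq_zero_of_forall_condCoeff_eq {ι : Type*} [Infinite ι] {a : A} {b : ι → A}
    (hb : Function.Injective b) {c : ℂ} (hc : ∀ i, condCoeff m μ a (b i) = c) : c = 0 :=
  eq_zero_of_forall_coeff_eq μ ((memLp_char μ a 2).condExp one_le_two) hb hc

theorem hasSum_condCoeff_mul_coeff {f : DiscreteDual A → ℂ} (hf : MemLp f 2 μ) (a : A) :
    HasSum (fun b => condCoeff m μ b a * coeff μ f b) (coeff μ (μ[f | m]) a) := by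
  rw [coeff_condExp_eq_integral hm hf]
  simp only [← conj_condCoeff hm a]
  exact hasSum_conj_coeff_mul_coeff μ ((memLp_char μ a 2).condExp one_le_two) hf

/-- Both sides are the coefficient at `c` of `E(E(a) b) = E(a) E(b)`. -/
theorem tsum_condCoeff_mul_condCoeff_sub (a b c : A) :
    ∑' d, condCoeff m μ d c * condCoeff m μ a (d - b) =
      ∑' d, condCoeff m μ a (c - d) * condCoeff m μ b d := by
  have ha : MemLp (μ[char a | m]) 2 μ := (memLp_char μ a 2).condExp one_le_two
  have hb : MemLp (μ[char b | m]) 2 μ := (memLp_char μ b 2).condExp one_le_two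
  have hab : MemLp (fun χ => (μ[char a | m]) χ * char b χ) 2 μ := MemLp.mul' (memLp_char μ b ⊤) ha
  have hpull : μ[fun χ => (μ[char a | m]) χ * char b χ | m] =ᵐ[μ]
      fun χ => (μ[char a | m]) χ * (μ[char b | m]) χ :=
    condExp_bilin_of_aestronglyMeasurable_left (.mul ℝ ℂ)
      stronglyMeasurable_condExp.aestronglyMeasurable (hab.integrable one_le_two)
      ((memLp_char μ b 2).integrable one_le_two)
  calc ∑' d, condCoeff m μ d c * condCoeff m μ a (d - b)
      = coeff μ (μ[fun χ => (μ[char a | m]) χ * char b χ | m]) c := by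
        rw [← (hasSum_condCoeff_mul_coeff hm hab c).tsum_eq]
        simp only [coeff_mul_char, condCoeff]
    _ = coeff μ (fun χ => (μ[char a | m]) χ * (μ[char b | m]) χ) c := by
        rw [coeff_congr_ae μ hpull]
    _ = ∑' d, condCoeff m μ a (c - d) * condCoeff m μ b d :=
        (hasSum_coeff_sub_mul_coeff μ ha hb c).tsum_eq.symm

theorem condExp_ae_eq_integral_of_condExp_char_ae_eq_zero
    (hzero : ∀ a : A, a ≠ 0 → μ[char a | m] =ᵐ[μ] 0) {f : DiscreteDual A → ℂ} (hf : MemLp f 2 μ) :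
    μ[f | m] =ᵐ[μ] fun _ => ∫ χ, f χ ∂μ := by
  refine ae_eq_of_coeff_eq μ (hf.condExp one_le_two) (memLp_const _) fun a => ?_
  rcases eq_or_ne a 0 with rfl | ha
  · rw [coeff_zero_right, coeff_zero_right, integral_condExp hm, integral_const, probReal_univ,
      one_smul]
  · have hleft : coeff μ (μ[f | m]) a = 0 := by
      rw [coeff_condExp_eq_integral hm hf]
      refine integral_eq_zero_of_ae ?_
      filter_upwards [hzero a ha] with χ hχ
      rw [hχ, Pi.zero_apply, map_zero, zero_mul]
    rw [hleft, coeff]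
    simp only [conj_char_apply, integral_mul_const,
      integral_char_eq_zero μ (neg_ne_zero.2 ha), zero_mul]

theorem ae_mem_or_ae_notMem_of_condExp_char_ae_eq_zero
    (hzero : ∀ a : A, a ≠ 0 → μ[char a | m] =ᵐ[μ] 0) {S : Set (DiscreteDual A)}
    (hS : MeasurableSet[m] S) : (∀ᵐ χ ∂μ, χ ∈ S) ∨ ∀ᵐ χ ∂μ, χ ∉ S := by
  have hf : MemLp (S.indicator fun _ => (1 : ℂ)) 2 μ := (memLp_const 1).indicator (hm S hS)
  have hconst := condExp_ae_eq_integral_of_condExp_char_ae_eq_zero hm hzero hf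
  rw [condExp_of_stronglyMeasurable hm (stronglyMeasurable_const.indicator hS)
    (hf.integrable one_le_two)] at hconst
  by_cases hint : ∫ χ, S.indicator (fun _ => (1 : ℂ)) χ ∂μ = 0
  · right
    filter_upwards [hconst] with χ hχ hmem
    rw [hint, Set.indicator_of_mem hmem] at hχ
    exact one_ne_zero hχ
  · left
    filter_upwards [hconst] with χ hχ
    by_contra hmem
    rw [Set.indicator_of_notMem hmem] at hχ
    exact hint hχ.symm

end CondExp

end DiscreteDual

namespace RatPlane

instance : Countable RatPlane := inferInstanceAs (Countable (Fin 2 → ℚ))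

instance : Module ℚ RatPlane := inferInstanceAs (Module ℚ (Fin 2 → ℚ))

instance : IsAddTorsionFree RatPlane := inferInstanceAs (IsAddTorsionFree (Fin 2 → ℚ))

/-- The vector of `ℚ²` with coordinates `a` and `b`. -/
def vec (a b : ℚ) : RatPlane := ![a, b]

theorem ext_coord {v w : RatPlane} (h0 : v 0 = w 0) (h1 : v 1 = w 1) : v = w :=
  funext (Fin.forall_fin_two.2 ⟨h0, h1⟩)

theorem exists_eq_vec (v : RatPlane) : ∃ a b, v = vec a b := ⟨v 0, v 1, ext_coord rfl rfl⟩

theorem smul_vec (x a b : ℚ) : x • vec a b = vec (x * a) (x * b) := ext_coord rfl rfl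

theorem add_vec (a b c d : ℚ) : vec a b + vec c d = vec (a + c) (b + d) := ext_coord rfl rfl

theorem sub_vec (a b c d : ℚ) : vec a b - vec c d = vec (a - c) (b - d) := ext_coord rfl rfl

theorem vec_inj {a b c d : ℚ} : vec a b = vec c d ↔ a = c ∧ b = d :=
  ⟨fun h => ⟨congrFun h 0, congrFun h 1⟩, fun ⟨h0, h1⟩ => ext_coord h0 h1⟩

theorem vec_ne_zero {a b : ℚ} : vec a b ≠ 0 ↔ a ≠ 0 ∨ b ≠ 0 := by
  have hzero : (0 : RatPlane) = vec 0 0 := ext_coord rfl rfl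
  rw [hzero, Ne, vec_inj, not_and_or]

theorem act_vec (g : SL(2, ℚ)) (a b : ℚ) :
    act g (vec a b) = vec (g.1 0 0 * a + g.1 0 1 * b) (g.1 1 0 * a + g.1 1 1 * b) :=
  ext_coord (Fin.sum_univ_two fun j => g.1 0 j * vec a b j)
    (Fin.sum_univ_two fun j => g.1 1 j * vec a b j)

theorem act_smul (g : SL(2, ℚ)) (x : ℚ) (v : RatPlane) : act g (x • v) = x • act g v :=
  Matrix.mulVec_smul _ _ _

theorem act_injective {g h : SL(2, ℚ)} (hgh : ∀ v, act g v = act h v) : g = h :=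
  Subtype.ext (Matrix.mulVec_injective (funext hgh))

theorem mem_center_of_act_eq {g : SL(2, ℚ)} (hg : ∀ v, act g v = v) :
    g ∈ Subgroup.center SL(2, ℚ) := by
  rw [act_injective (g := g) (h := 1) fun v => by rw [hg, act_one]]
  exact one_mem _

theorem mem_center_of_act_eq_neg {g : SL(2, ℚ)} (hg : ∀ v, act g v = -v) :
    g ∈ Subgroup.center SL(2, ℚ) :=
  Subgroup.mem_center_iff.2 fun h => act_injective fun v => by
    rw [act_mul, act_mul, hg, hg, act_neg]

theorem exists_act_eq {v : RatPlane} (hv : v ≠ 0) : ∃ g : SL(2, ℚ), act g (vec 1 0) = v := by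
  obtain ⟨a, b, rfl⟩ := exists_eq_vec v
  rcases eq_or_ne a 0 with rfl | ha
  · have hb : b ≠ 0 := (vec_ne_zero.1 hv).resolve_left (not_not_intro rfl)
    refine ⟨⟨!![0, -b⁻¹; b, 0], by simp [hb]⟩, ?_⟩
    exact (act_vec _ 1 0).trans (vec_inj.2 (by simp))
  · refine ⟨⟨!![a, 0; b, a⁻¹], by simp [ha]⟩, ?_⟩
    exact (act_vec _ 1 0).trans (vec_inj.2 (by simp))

/-- The determinant `det (v, w)` of two vectors of `ℚ²`, used to express that they are
proportional. -/
def cross (v w : RatPlane) : ℚ := v 0 * w 1 - v 1 * w 0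

theorem cross_vec (a b c d : ℚ) : cross (vec a b) (vec c d) = a * d - b * c := rfl

theorem cross_self (v : RatPlane) : cross v v = 0 := sub_eq_zero.2 (mul_comm _ _)

theorem cross_zero_left (w : RatPlane) : cross 0 w = 0 :=
  sub_eq_zero.2 ((zero_mul _).trans (zero_mul _).symm)

theorem exists_smul_eq_of_cross_eq_zero {v w : RatPlane} (hv : v ≠ 0) (h : cross v w = 0) :
    ∃ x : ℚ, x • v = w := by
  obtain ⟨a, b, rfl⟩ := exists_eq_vec v
  obtain ⟨c, d, rfl⟩ := exists_eq_vec w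
  rw [cross_vec] at h
  simp only [smul_vec, vec_inj]
  rcases vec_ne_zero.1 hv with ha | hb
  · exact ⟨c / a, div_mul_cancel₀ _ ha, by field_simp; linear_combination -h⟩
  · exact ⟨d / b, by field_simp; linear_combination h, div_mul_cancel₀ _ hb⟩

/-- The transvection `w ↦ w + t det (v, w) v`, which fixes `v`. -/
def transvection (v : RatPlane) (t : ℚ) : SL(2, ℚ) :=
  ⟨!![1 - t * v 0 * v 1, t * v 0 ^ 2; -t * v 1 ^ 2, 1 + t * v 0 * v 1], by
    rw [Matrix.det_fin_two_of]
    ring⟩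

theorem act_transvection (v : RatPlane) (t : ℚ) (w : RatPlane) :
    act (transvection v t) w = w + (t * cross v w) • v := by
  obtain ⟨a, b, rfl⟩ := exists_eq_vec v
  obtain ⟨c, d, rfl⟩ := exists_eq_vec w
  rw [act_vec, cross_vec, smul_vec, add_vec, vec_inj]
  constructor <;> simp [transvection, vec] <;> ring

/-- The diagonal matrix with entries `2ⁿ` and `2⁻ⁿ`; the action is mixing along this sequence. -/
def diagPow (n : ℕ) : SL(2, ℚ) :=
  ⟨!![2 ^ n, 0; 0, (2 ^ n)⁻¹], by simp⟩

theorem act_diagPow_vec (n : ℕ) (a b : ℚ) :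
    act (diagPow n) (vec a b) = vec (2 ^ n * a) ((2 ^ n)⁻¹ * b) := by
  rw [act_vec]
  simp [diagPow]

theorem tendsto_act_diagPow_cofinite {v : RatPlane} (hv : v ≠ 0) :
    Tendsto (fun n => act (diagPow n) v) atTop cofinite := by
  obtain ⟨a, b, rfl⟩ := exists_eq_vec v
  rw [← Nat.cofinite_eq_atTop]
  refine Function.Injective.tendsto_cofinite fun m n hmn => ?_
  simp only [act_diagPow_vec, vec_inj] at hmn
  have hpow : Function.Injective fun n : ℕ => (2 : ℚ) ^ n :=
    pow_right_injective₀ two_pos (by norm_num)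
  rcases vec_ne_zero.1 hv with ha | hb
  · exact hpow (mul_right_cancel₀ ha hmn.1)
  · exact hpow (inv_injective (mul_right_cancel₀ hb hmn.2))

end RatPlane

namespace DualRatPlane

open RatPlane DiscreteDual

instance : SecondCountableTopology DualRatPlane :=
  have : Countable (Multiplicative RatPlane) := inferInstanceAs (Countable RatPlane)
  (ContinuousMonoidHom.isInducing_toContinuousMap
    (Multiplicative RatPlane) Circle).secondCountableTopology

instance : PolishSpace DualRatPlane :=
  letI := TopologicalSpace.metrizableSpaceMetric DualRatPlane
  inferInstance

instance : haar.IsHaarMeasure := inferInstanceAs (Measure.haarMeasure ⊤).IsHaarMeasure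

instance : IsProbabilityMeasure haar :=
  ⟨Measure.haarMeasure_self (K₀ := (⊤ : TopologicalSpace.PositiveCompacts DualRatPlane))⟩

theorem char_smul_apply (g : SL(2, ℚ)) (v : RatPlane) (χ : DualRatPlane) :
    char v (g • χ) = char (act g⁻¹ v) χ := rfl

theorem isPMPAction : IsPMPAction SL(2, ℚ) haar where
  isProbabilityMeasure := inferInstance
  measurePreserving g :=
    MonoidHom.measurePreserving (f := (PontryaginDual.map (actHom g⁻¹)).toMonoidHom)
      (PontryaginDual.map (actHom g⁻¹)).continuous_toFun (MulAction.surjective g) rfl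

section Quotient

variable {Z : Type*} [MulAction SL(2, ℚ) Z] [mZ : MeasurableSpace Z] {ν : Measure Z}
  {π : DualRatPlane → Z} (hπ : IsQuotientAction SL(2, ℚ) haar ν π)

/-- The Fourier coefficient at `x v` of the conditional expectation of the character `v` given `π`.
For a quotient map `π` of the action of `SL₂(ℚ)` it is the same for every `v ≠ 0`. -/
def scalarCoeff (π : DualRatPlane → Z) (x : ℚ) : ℂ :=
  condCoeff (mZ.comap π) haar (vec 1 0) (x • vec 1 0)

include hπ

theorem condCoeff_act_act (g : SL(2, ℚ)) (v w : RatPlane) :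
    condCoeff (mZ.comap π) haar (act g v) (act g w) = condCoeff (mZ.comap π) haar v w := by
  have hchar : ∀ u χ, char u (g⁻¹ • χ) = char (act g u) χ := fun u χ => by
    rw [char_smul_apply, inv_inv]
  have hexp : haar[char (act g v) | mZ.comap π] =ᵐ[haar]
      fun χ => (haar[char v | mZ.comap π]) (g⁻¹ • χ) := by
    refine ((hπ.condExp_comp_smul isPMPAction ((memLp_char haar v 2).integrable one_le_two)
      g⁻¹).trans ?_).symm
    simp only [hchar]
    rfl
  rw [condCoeff, condCoeff, coeff_congr_ae haar hexp, coeff, coeff]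
  simp only [← hchar]
  exact (isPMPAction.measurePreserving g⁻¹).integral_comp
    (isPMPAction.measurableEmbedding_smul g⁻¹)
    fun χ => conj (char w χ) * (haar[char v | mZ.comap π]) χ

/-- The transvections along `v` fix `v` and move `w` to infinitely many vectors, so that the
conditional expectation of `v` has infinitely many equal Fourier coefficients. -/
theorem condCoeff_eq_zero_of_cross_ne_zero {v w : RatPlane} (h : cross v w ≠ 0) :
    condCoeff (mZ.comap π) haar v w = 0 := by
  have hv : v ≠ 0 := by
    rintro rfl
    exact h (cross_zero_left w)
  have hinj : Function.Injective fun t : ℚ => act (transvection v t) w := fun s t hst => by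
    simp only [act_transvection, add_right_inj] at hst
    exact mul_right_cancel₀ h (smul_left_injective ℚ hv hst)
  have hconst (t : ℚ) : condCoeff (mZ.comap π) haar v (act (transvection v t) w) =
      condCoeff (mZ.comap π) haar v w := by
    have hfix : act (transvection v t) v = v := by
      rw [act_transvection, cross_self, mul_zero, zero_smul, add_zero]
    rw [← condCoeff_act_act hπ (transvection v t) v w, hfix]
  exact eq_zero_of_forall_condCoeff_eq hinj hconst

theorem condCoeff_smul_right {v : RatPlane} (hv : v ≠ 0) (x : ℚ) :
    condCoeff (mZ.comap π) haar v (x • v) = scalarCoeff π x := by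
  obtain ⟨g, rfl⟩ := exists_act_eq hv
  rw [← act_smul, condCoeff_act_act hπ, scalarCoeff]

/-- Evaluate `E(E(a) b) = E(a) E(b)` for `a = (1, 0)` and `b = (0, 1)` at `(x, y)`. -/
theorem scalarCoeff_mul_scalarCoeff_div (x : ℚ) {y : ℚ} (hy : y ≠ 0) :
    scalarCoeff π y * scalarCoeff π (x / y) = scalarCoeff π x * scalarCoeff π y := by
  have ha : vec 1 0 ≠ 0 := vec_ne_zero.2 (.inl one_ne_zero)
  have hb : vec 0 1 ≠ 0 := vec_ne_zero.2 (.inr one_ne_zero)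
  have hd : vec (x / y) 1 ≠ 0 := vec_ne_zero.2 (.inr one_ne_zero)
  have hsum := tsum_condCoeff_mul_condCoeff_sub hπ.measurePreserving.measurable.comap_le (μ := haar)
    (vec 1 0) (vec 0 1) (vec x y)
  rw [tsum_eq_single (vec (x / y) 1), tsum_eq_single (vec 0 y)] at hsum
  · have hc : vec x y = y • vec (x / y) 1 := by rw [smul_vec, mul_div_cancel₀ _ hy, mul_one]
    have hdb : vec (x / y) 1 - vec 0 1 = (x / y) • vec 1 0 := by simp [sub_vec, smul_vec]
    have hcb : vec x y - vec 0 y = x • vec 1 0 := by simp [sub_vec, smul_vec]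
    have hyb : vec 0 y = y • vec 0 1 := by simp [smul_vec]
    rw [hdb, hcb, hc, hyb] at hsum
    simpa only [condCoeff_smul_right hπ ha, condCoeff_smul_right hπ hb,
      condCoeff_smul_right hπ hd] using hsum
  · intro u hu
    obtain ⟨c, d, rfl⟩ := exists_eq_vec u
    rw [Ne, vec_inj, not_and_or] at hu
    rcases hu with hc | hd
    · rw [condCoeff_eq_zero_of_cross_ne_zero hπ (v := vec 0 1), mul_zero]
      simpa [cross_vec] using hc
    · rw [condCoeff_eq_zero_of_cross_ne_zero hπ (v := vec 1 0), zero_mul]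
      simpa [sub_vec, cross_vec, sub_eq_zero, eq_comm] using hd
  · intro u hu
    obtain ⟨c, d, rfl⟩ := exists_eq_vec u
    rcases eq_or_ne d 1 with rfl | hd
    · rw [condCoeff_eq_zero_of_cross_ne_zero hπ, zero_mul]
      rw [cross_vec, one_mul, sub_ne_zero]
      exact fun hcx => hu (vec_inj.2 ⟨eq_div_of_mul_eq hy hcx, rfl⟩)
    · rw [condCoeff_eq_zero_of_cross_ne_zero hπ (v := vec 1 0), mul_zero]
      simpa [sub_vec, cross_vec, sub_eq_zero] using hd

/-- If the coefficient at `y` does not vanish, then all coefficients at the powers of `y⁻¹` are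
equal, contradicting square-summability. -/
theorem scalarCoeff_eq_zero_of_abs_ne_one {y : ℚ} (hy : |y| ≠ 1) : scalarCoeff π y = 0 := by
  have hv : vec 1 0 ≠ 0 := vec_ne_zero.2 (.inl one_ne_zero)
  rcases eq_or_ne y 0 with rfl | hy0
  · rw [scalarCoeff, zero_smul, condCoeff_zero_right hπ.measurePreserving.measurable.comap_le hv]
  by_contra hc
  have hdiv : ∀ x, scalarCoeff π (x / y) = scalarCoeff π x := fun x =>
    mul_left_cancel₀ hc ((scalarCoeff_mul_scalarCoeff_div hπ x hy0).trans (mul_comm _ _))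
  have hpow : ∀ n : ℕ, scalarCoeff π (y⁻¹ ^ n) = scalarCoeff π y := by
    intro n
    induction n with
    | zero => rw [pow_zero, ← hdiv y, div_self hy0]
    | succ n ih => rw [pow_succ, ← div_eq_mul_inv, hdiv, ih]
  have hinj : Function.Injective fun n : ℕ => y⁻¹ ^ n := by
    refine Function.Injective.of_comp (f := fun x : ℚ => |x|) ?_
    simpa only [Function.comp_def, abs_pow, abs_inv] using
      pow_right_injective₀ (inv_pos.2 (abs_pos.2 hy0)) (inv_ne_one.2 hy)
  exact hc (eq_zero_of_forall_condCoeff_eq ((smul_left_injective ℚ hv).comp hinj) hpow)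

theorem condCoeff_eq_zero_of_ne_of_ne_neg {v w : RatPlane} (hv : v ≠ 0) (hw : w ≠ v)
    (hw' : w ≠ -v) : condCoeff (mZ.comap π) haar v w = 0 := by
  by_cases hcross : cross v w = 0
  · obtain ⟨x, rfl⟩ := exists_smul_eq_of_cross_eq_zero hv hcross
    rw [condCoeff_smul_right hπ hv, scalarCoeff_eq_zero_of_abs_ne_one hπ]
    rw [Ne, abs_eq zero_le_one]
    rintro (rfl | rfl)
    · exact hw (one_smul _ _)
    · exact hw' (neg_one_smul _ _)
  · exact condCoeff_eq_zero_of_cross_ne_zero hπ hcross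

variable (hinv : ∀ χ, π χ⁻¹ = π χ)

include hinv

theorem condExp_char_ae_eq {v : RatPlane} (hv : v ≠ 0) :
    haar[char v | mZ.comap π] =ᵐ[haar]
      fun χ => scalarCoeff π 1 * (char v χ + char (-v) χ) := by
  classical
  have hmem := (memLp_char haar v 2).add (memLp_char haar (-v) 2)
  have hself : condCoeff (mZ.comap π) haar v v = scalarCoeff π 1 := by
    rw [← condCoeff_smul_right hπ hv, one_smul]
  have hneg : condCoeff (mZ.comap π) haar v (-v) = scalarCoeff π 1 := by
    rw [← hself]
    refine coeff_neg_of_comp_inv haar (fun χ => ?_) v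
    obtain ⟨h, -, hhπ⟩ := (stronglyMeasurable_condExp (μ := haar) (f := char v)
      (m := mZ.comap π)).exists_eq_measurable_comp
    rw [hhπ, Function.comp_apply, Function.comp_apply, hinv]
  have hne : v ≠ -v := fun h => hv (self_eq_neg.1 h)
  refine ae_eq_of_coeff_eq haar ((memLp_char haar v 2).condExp one_le_two) (hmem.const_mul _)
    fun w => ?_
  change condCoeff (mZ.comap π) haar v w =
    coeff haar (fun χ => scalarCoeff π 1 * (⇑(char v) + ⇑(char (-v))) χ) w
  rw [coeff_const_mul, coeff_add haar (memLp_char haar v 2) (memLp_char haar (-v) 2), coeff_char,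
    coeff_char]
  by_cases hw : w = v
  · rw [hw, hself, if_pos rfl, if_neg hne, add_zero, mul_one]
  by_cases hw' : w = -v
  · rw [hw', hneg, if_neg hne.symm, if_pos rfl, zero_add, mul_one]
  · rw [condCoeff_eq_zero_of_ne_of_ne_neg hπ hv hw hw', if_neg hw, if_neg hw', add_zero, mul_zero]

theorem exists_ae_eq_const_of_scalarCoeff_one_eq_zero [MeasurableSpace.CountablySeparated Z]
    (h1 : scalarCoeff π 1 = 0) : ∃ z₀, ∀ᵐ χ ∂haar, π χ = z₀ := by
  have : Nonempty Z := ⟨π 1⟩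
  have hzero : ∀ v : RatPlane, v ≠ 0 → haar[char v | mZ.comap π] =ᵐ[haar] 0 := fun v hv => by
    filter_upwards [condExp_char_ae_eq hπ hinv hv] with χ hχ
    rw [hχ, h1, zero_mul, Pi.zero_apply]
  exact Filter.exists_eventuallyEq_const_of_forall_separating MeasurableSet fun U hU =>
    ae_mem_or_ae_notMem_of_condExp_char_ae_eq_zero hπ.measurePreserving.measurable.comap_le hzero
      (S := π ⁻¹' U) ⟨U, hU, rfl⟩

theorem exists_comp_ae_eq_re_char_of_scalarCoeff_one_ne_zero (h1 : scalarCoeff π 1 ≠ 0)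
    (v : RatPlane) :
    ∃ h : Z → ℝ, Measurable h ∧ ∀ᵐ χ ∂haar, h (π χ) = (char v χ).re := by
  rcases eq_or_ne v 0 with rfl | hv
  · exact ⟨fun _ => 1, measurable_const, ae_of_all _ fun χ => by simp [char_zero]⟩
  obtain ⟨h, hh, hhπ⟩ := (stronglyMeasurable_condExp (μ := haar) (f := char v)
    (m := mZ.comap π)).exists_eq_measurable_comp
  refine ⟨fun z => (h z / (scalarCoeff π 1 * 2)).re,
    Complex.measurable_re.comp (hh.measurable.div_const _), ?_⟩
  filter_upwards [condExp_char_ae_eq hπ hinv hv] with χ hχ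
  rw [hhπ, Function.comp_apply, ← conj_char_apply, Complex.add_conj, Complex.ofReal_mul,
    Complex.ofReal_ofNat, ← mul_assoc] at hχ
  rw [hχ, mul_div_cancel_left₀ _ (mul_ne_zero h1 two_ne_zero), Complex.ofReal_re]

end Quotient

end DualRatPlane

namespace FlipQuotient

open RatPlane DualRatPlane DiscreteDual

theorem measurable_mk : Measurable mk := fun _ h => h

theorem measurePreserving_mk : MeasurePreserving mk haar measure := ⟨measurable_mk, rfl⟩

instance : IsProbabilityMeasure measure :=
  Measure.isProbabilityMeasure_map measurable_mk.aemeasurable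

theorem mk_surjective : Function.Surjective mk := Quotient.mk_surjective

theorem mk_eq_mk {χ ψ : DualRatPlane} : mk χ = mk ψ ↔ ψ = χ ∨ ψ = χ⁻¹ := by
  have hinv (v : RatPlane) : χ.pairing (-v) = pairing χ⁻¹ v :=
    Circle.ext (char_inv_apply v χ).symm
  refine (Quotient.eq (r := flipSetoid)).trans (or_congr_right ?_)
  simp only [hinv]
  exact ⟨pairing_ext, fun h v => by rw [h]⟩

theorem isPMPAction : IsPMPAction PSL(2, ℚ) measure where
  isProbabilityMeasure := inferInstance
  measurePreserving γ := by
    obtain ⟨g, rfl⟩ := QuotientGroup.mk_surjective γ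
    have hcomp := measurePreserving_mk.comp (DualRatPlane.isPMPAction.measurePreserving g)
    have hmeas : Measurable fun y : FlipQuotient => (QuotientGroup.mk g : PSL(2, ℚ)) • y :=
      fun s hs => hcomp.measurable hs
    exact ⟨hmeas, (Measure.map_map hmeas measurable_mk).trans hcomp.map_eq⟩

theorem ae_smul_ne_and_smul_ne_inv {g : SL(2, ℚ)} (hg : g ∉ Subgroup.center SL(2, ℚ)) :
    ∀ᵐ χ ∂haar, g • χ ≠ χ ∧ g • χ ≠ χ⁻¹ := by
  have hg' : g⁻¹ ∉ Subgroup.center SL(2, ℚ) := mt inv_mem_iff.1 hg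
  have hne : act g⁻¹ ≠ fun v => v := fun h => hg' (mem_center_of_act_eq (congrFun h))
  have hne' : act g⁻¹ ≠ fun v => -v := fun h => hg' (mem_center_of_act_eq_neg (congrFun h))
  filter_upwards [ae_exists_char_ne haar hne, ae_exists_char_ne haar hne'] with χ ⟨v, hv⟩ ⟨w, hw⟩
  exact ⟨fun h => hv (by rw [← char_smul_apply, h]),
    fun h => hw (by rw [← char_smul_apply, h, char_inv_apply])⟩

theorem isFreeAction : IsFreeAction PSL(2, ℚ) measure := by
  intro γ hγ
  obtain ⟨g, rfl⟩ := QuotientGroup.mk_surjective γ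
  rw [Ne, QuotientGroup.eq_one_iff] at hγ
  have hne (χ : DualRatPlane) : (QuotientGroup.mk g : PSL(2, ℚ)) • mk χ ≠ mk χ ↔
      g • χ ≠ χ ∧ g • χ ≠ χ⁻¹ := by
    rw [psl_smul_mk, ne_comm, Ne, mk_eq_mk, not_or]
  have hcont : Continuous fun χ : DualRatPlane => g • χ :=
    (PontryaginDual.map (actHom g⁻¹)).continuous_toFun
  have hmeas : MeasurableSet {y : FlipQuotient | (QuotientGroup.mk g : PSL(2, ℚ)) • y ≠ y} := by
    change MeasurableSet {χ | (QuotientGroup.mk g : PSL(2, ℚ)) • mk χ ≠ mk χ}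
    simp only [hne]
    exact (isOpen_ne_fun hcont continuous_id).measurableSet.inter
      (isOpen_ne_fun hcont continuous_inv).measurableSet
  refine (ae_map_iff measurable_mk.aemeasurable hmeas).2 ?_
  simpa only [hne] using ae_smul_ne_and_smul_ne_inv hγ

theorem isWeaklyMixingAction : IsWeaklyMixingAction PSL(2, ℚ) measure := by
  refine isWeaklyMixingAction_of_tendsto (l := atTop) (fun n => QuotientGroup.mk (diagPow n))
    fun S S' hS hS' => ?_
  have hmix := tendsto_measureReal_preimage_inter haar
    (fun n => DualRatPlane.isPMPAction.measurePreserving (diagPow n)⁻¹)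
    (σ := fun n => act (diagPow n)) (fun n v χ => by rw [char_smul_apply, inv_inv])
    (fun v hv => tendsto_act_diagPow_cofinite hv) (measurable_mk hS) (measurable_mk hS')
  have hmk {U : Set FlipQuotient} (hU : MeasurableSet U) :
      haar.real (mk ⁻¹' U) = measure.real U :=
    measurePreserving_mk.measureReal_preimage hU.nullMeasurableSet
  rw [hmk hS, hmk hS'] at hmix
  refine hmix.congr fun n => ?_
  rw [← hmk (((isPMPAction.measurePreserving _).measurable hS).inter hS')]
  rfl

/-- The real parts of the characters, as functions on `Y`. Jointly they embed `Y` in a product of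
lines. -/
def reChar : FlipQuotient → RatPlane → ℝ :=
  Quotient.lift (fun χ v => (char v χ).re) (by
    rintro φ ψ (rfl | h)
    · rfl
    · funext v
      have hψ : char v ψ = conj (char v φ) :=
        (congrArg Circle.coeHom (h v)).trans (conj_char_apply v φ).symm
      rw [hψ, Complex.conj_re])

theorem injective_reChar : Function.Injective reChar := by
  intro y y' h
  obtain ⟨χ, rfl⟩ := mk_surjective y
  obtain ⟨ψ, rfl⟩ := mk_surjective y'
  exact mk_eq_mk.2 (eq_or_eq_inv_of_re_char_eq fun v => (congrFun h v).symm)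

theorem measurableEmbedding_reChar : MeasurableEmbedding reChar := by
  have hcont : Continuous (reChar ∘ mk) :=
    continuous_pi fun v => Complex.continuous_re.comp (char v).continuous
  refine ⟨injective_reChar, fun s hs => hcont.measurable hs, fun s hs => ?_⟩
  have himage := (hcont.measurable.measurableSet_preimage_iff_inter_range
    (isCompact_range hcont).measurableSet (s := reChar '' s)).1 (by
      rwa [Set.preimage_comp, Set.preimage_image_eq _ injective_reChar])
  rwa [mk_surjective.range_comp, Set.inter_eq_left.2 (Set.image_subset_range _ _)] at himage

theorem isIsoModNull_of_comp_ae_eq_re_char {Z : Type*} [MeasurableSpace Z] [MeasurableEq Z]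
    {ν : Measure Z} {p : FlipQuotient → Z} (hp : MeasurePreserving p measure ν)
    (h : ∀ v, ∃ h : Z → ℝ, Measurable h ∧ ∀ᵐ χ ∂haar, h (p (mk χ)) = (char v χ).re) :
    IsIsoModNull measure ν p := by
  choose h hh hhp using h
  have hF : Measurable fun z v => h v z := measurable_pi_iff.2 hh
  have : Nonempty FlipQuotient := ⟨mk 1⟩
  refine isIsoModNull_of_comp_ae_eq hp measurableEmbedding_reChar hF ?_
  refine (ae_map_iff measurable_mk.aemeasurable (measurableSet_eq_fun
    (hF.comp hp.measurable) measurableEmbedding_reChar.measurable)).2 ?_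
  filter_upwards [ae_all_iff.2 hhp] with χ hχ
  exact funext hχ

theorem exists_ae_eq_or_isIsoModNull_of_isQuotientAction {Z : Type*} [MeasurableSpace Z]
    [MeasurableSpace.CountablySeparated Z] [MulAction PSL(2, ℚ) Z] {ν : Measure Z}
    {p : FlipQuotient → Z} (hp : IsQuotientAction PSL(2, ℚ) measure ν p) :
    (∃ z₀, ∀ᵐ z ∂ν, z = z₀) ∨ IsIsoModNull measure ν p := by
  have : MeasurableEq Z := measurableEq_of_countablySeparated
  let : MulAction SL(2, ℚ) Z :=
    MulAction.compHom Z (QuotientGroup.mk' (Subgroup.center SL(2, ℚ)))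
  have hmp : MeasurePreserving (p ∘ mk) haar ν :=
    hp.measurePreserving.comp measurePreserving_mk
  have hπ : IsQuotientAction SL(2, ℚ) haar ν (p ∘ mk) :=
    { isPMPAction := ⟨hp.isPMPAction.isProbabilityMeasure,
        fun g => hp.isPMPAction.measurePreserving (QuotientGroup.mk g)⟩
      measurePreserving := hmp
      equivariant := fun g => ae_of_ae_map measurable_mk.aemeasurable
        (hp.equivariant (QuotientGroup.mk g)) }
  have hinv (χ : DualRatPlane) : (p ∘ mk) χ⁻¹ = (p ∘ mk) χ :=
    congrArg p (mk_eq_mk.2 (.inr (inv_inv χ).symm))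
  by_cases h1 : scalarCoeff (p ∘ mk) 1 = 0
  · left
    obtain ⟨z₀, hz₀⟩ := exists_ae_eq_const_of_scalarCoeff_one_eq_zero hπ hinv h1
    refine ⟨z₀, ?_⟩
    rw [← hmp.map_eq]
    exact (ae_map_iff hmp.measurable.aemeasurable (measurableSet_singleton z₀)).2 hz₀
  · exact .inr (isIsoModNull_of_comp_ae_eq_re_char hp.measurePreserving
      (exists_comp_ae_eq_re_char_of_scalarCoeff_one_ne_zero hπ hinv h1))

end FlipQuotient

end

theorem mainTheorem8_general :
    IsPMPAction PSL(2, ℚ) FlipQuotient.measure ∧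
    IsFreeAction PSL(2, ℚ) FlipQuotient.measure ∧
    IsWeaklyMixingAction PSL(2, ℚ) FlipQuotient.measure ∧
    ∀ (Z : Type u) [MeasurableSpace Z] [MeasurableSpace.CountablySeparated Z]
      [MulAction PSL(2, ℚ) Z] (ν : Measure Z) (p : FlipQuotient → Z),
      IsQuotientAction PSL(2, ℚ) FlipQuotient.measure ν p →
        (∃ z₀ : Z, ∀ᵐ z ∂ν, z = z₀) ∨ IsIsoModNull FlipQuotient.measure ν p :=
  ⟨FlipQuotient.isPMPAction, FlipQuotient.isFreeAction, FlipQuotient.isWeaklyMixingAction,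
    fun _ _ _ _ _ _ => FlipQuotient.exists_ae_eq_or_isIsoModNull_of_isQuotientAction⟩

theorem mainTheorem8 :
    IsPMPAction PSL(2, ℚ) FlipQuotient.measure ∧
    IsFreeAction PSL(2, ℚ) FlipQuotient.measure ∧
    IsWeaklyMixingAction PSL(2, ℚ) FlipQuotient.measure ∧
    IsPrimeAction.{u, 0, 0} PSL(2, ℚ) FlipQuotient.measure :=
  let ⟨hpmp, hfree, hmixing, hprime⟩ := mainTheorem8_general.{u}
  ⟨hpmp, hfree, hmixing, fun Z _ _ _ => hprime Z⟩
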